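/- Let $R$ be a Noetherian local ring with residue field $k$, and let $Q$ be its total ring of fractions. Let $E$ be a finitely generated $R$-module of projective dimension $1$ having rank $e \ge 0$, that is, $E \otimes_R Q \cong Q^e$. Then $$\ell\Big(\bigwedge\nolimits^{e} E\Big) \;\ge\; \operatorname{ht} F_e(E).$$ Here $F_e(E)$ is the $e$-th Fitting ideal of $E$: if $R^m \xrightarrow{\varphi} R^n \to E \to 0$ is any finite free presentation of $E$, then $F_e(E) = I_{n-e}(\varphi)$ is the ideal generated by the $(n-e)\times(n-e)$ minors of $\varphi$, with $I_0(\varphi) = R$. For a finitely generated $R$-module $M$ having a rank, the Rees algebra $\mathcal R(M)$ is the quotient $\mathcal S(M)/\tau_R(\mathcal S(M))$ of the symmetric algebra of $M$ by the ideal of all elements annihilated by a non-zero-divisor of $R$, and the analytic spread $\ell(M)$ is the Krull dimension of the fiber cone $\mathcal R(M) \otimes_R k$. -/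

import Mathlib

universe u v

open scoped TensorProduct

/-- `E` has rank `e`: `E ⊗ Q ≅ Q ^ e`, where `Q` is the total ring of fractions of `R`
(the localization of `R` at all its non-zero-divisors). -/
def HasModuleRank (R : Type*) [CommRing R] (E : Type*) [AddCommGroup E] [Module R E]
    (e : ℕ) : Prop :=
  Nonempty ((FractionRing R ⊗[R] E) ≃ₗ[FractionRing R] (Fin e → FractionRing R))

/-- The ideal `I_k(φ)` generated by the `k × k` minors of the matrix `φ`. Rows and columns are
chosen by arbitrary maps: repeating an index gives determinant `0`, and reordering indices only
changes the sign. So `I_0(φ) = R`, and `I_k(φ) = 0` when `k` exceeds the size of `φ`. -/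
def minorsIdeal {R : Type*} [CommRing R] {n m : ℕ} (φ : Matrix (Fin n) (Fin m) R) (k : ℕ) :
    Ideal R :=
  Ideal.span {d | ∃ (r : Fin k → Fin n) (c : Fin k → Fin m), d = (φ.submatrix r c).det}

/-- The exact sequence `R ^ m → R ^ n → E → 0` given by a matrix `φ` and a map `π` is a finite
free presentation of `E`. -/
def IsFreePresentation {R : Type*} [CommRing R] {E : Type*} [AddCommGroup E] [Module R E]
    {n m : ℕ} (φ : Matrix (Fin n) (Fin m) R) (π : (Fin n → R) →ₗ[R] E) : Prop :=
  Function.Exact φ.mulVecLin π ∧ Function.Surjective π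

/-- `I` is the `i`-th Fitting ideal `F_i(E)`: it is the ideal `I_{n-i}(φ)` of some finite free
presentation `R ^ m → R ^ n → E → 0` with matrix `φ` (and `F_i(E) = R` if `n ≤ i`). The ideal does
not depend on the presentation; a claim about every `I` with this property is a claim about
`I_{n-i}(φ)` for every finite free presentation. -/
def IsFittingIdeal (R : Type*) [CommRing R] (E : Type*) [AddCommGroup E] [Module R E]
    (i : ℕ) (I : Ideal R) : Prop :=
  ∃ (n m : ℕ) (φ : Matrix (Fin n) (Fin m) R) (π : (Fin n → R) →ₗ[R] E),
    IsFreePresentation φ π ∧ I = minorsIdeal φ (n - i)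

/-- A finitely generated module over a Noetherian ring has Fitting ideals. -/
theorem exists_isFittingIdeal (R : Type*) [CommRing R] [IsNoetherianRing R] (E : Type*)
    [AddCommGroup E] [Module R E] [Module.Finite R E] (i : ℕ) :
    ∃ I : Ideal R, IsFittingIdeal R E i I := by
  obtain ⟨n, π, hπ⟩ := Module.Finite.exists_fin' R E
  obtain ⟨m, ψ, hψ⟩ := Module.Finite.exists_fin' R (LinearMap.ker π)
  refine ⟨_, n, m, LinearMap.toMatrix' ((LinearMap.ker π).subtype ∘ₗ ψ), π, ⟨?_, hπ⟩, rfl⟩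
  rw [← Matrix.toLin'_apply', Matrix.toLin'_toMatrix']
  intro y
  constructor
  · intro hy
    obtain ⟨x, hx⟩ := hψ ⟨y, hy⟩
    exact ⟨x, by simp [hx]⟩
  · rintro ⟨x, rfl⟩
    exact (ψ x).2

/-- The `R`-torsion `τ_R(A)` of an `R`-algebra `A`, that is, the set of elements killed by a
non-zero-divisor of `R`, as an ideal of `A`. -/
def torsionIdeal (R : Type*) [CommRing R] (A : Type*) [CommRing A] [Algebra R A] : Ideal A where
  carrier := Submodule.torsion R A
  add_mem' := (Submodule.torsion R A).add_mem
  zero_mem' := (Submodule.torsion R A).zero_mem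
  smul_mem' := by
    rintro c x ⟨a, ha⟩
    refine ⟨a, ?_⟩
    have h : a • (c * x) = c * (a • x) := (mul_smul_comm a c x).symm
    rw [smul_eq_mul, h, ha, mul_zero]

/-- The Rees algebra of a module: its symmetric algebra modulo `R`-torsion. -/
abbrev ModuleReesAlgebra (R : Type*) [CommRing R] (E : Type*) [AddCommGroup E] [Module R E] :
    Type _ :=
  SymmetricAlgebra R E ⧸ torsionIdeal R (SymmetricAlgebra R E)

/-- The fiber cone: the Rees algebra tensored with the residue field. -/
abbrev FiberCone (R : Type*) [CommRing R] [IsLocalRing R] (E : Type*) [AddCommGroup E]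
    [Module R E] : Type _ :=
  ModuleReesAlgebra R E ⊗[R] IsLocalRing.ResidueField R

/-- The analytic spread `ℓ(E)`: the Krull dimension of the fiber cone. -/
noncomputable def analyticSpread (R : Type*) [CommRing R] [IsLocalRing R] (E : Type*)
    [AddCommGroup E] [Module R E] : WithBot ℕ∞ :=
  ringKrullDim (FiberCone R E)

-- Put `M = ⋀[R]^e E`. The proof produces a linear form on `M` whose image is a proper ideal `J`
-- containing `F_e(E)`, and then shows `ht J ≤ ℓ(M)`.
--
-- The form: since `E` has projective dimension 1 and `R` is local, the kernel of `π : R ^ n → E` is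
-- free, and the rank of `E` forces its rank to be `n - e`. For a basis `ψ` of the kernel, `det (v₁,
-- …, vₑ, ψ)` depends only on the images of the `vᵢ` in `E`, which gives `wedgeDet`. Taking standard
-- basis vectors for the `vᵢ` recovers the maximal minors of `ψ` up to units, and every presentation
-- matrix factors through `ψ`, so the image contains the Fitting ideal
-- (`minorsIdeal_le_range_wedgeDet`). Were the image all of `R`, some `v` would complete `ψ` to a
-- basis and `E` would be free, contradicting projective dimension 1
-- (`free_of_range_wedgeDet_eq_top`).
--
-- The height bound: a form `M → J` induces a map from the symmetric algebra to `R[t]` that kills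
-- torsion, so the fiber cone of `M` maps onto that of `J` (`height_range_le_analyticSpread`). If
-- the latter has dimension `n`, homogeneous parameters of it give `n` elements `a` of `J` with `J ^
-- N ⊆ (a)` by Nakayama. Then `J` and `(a)` have the same radical, and Krull's height theorem gives
-- `ht J ≤ n` (`height_span_range_le_ringKrullDim_fiber`).

attribute [local instance] MvPolynomial.gradedAlgebra

/-! ### Homogeneous prime avoidance and homogeneous parameters -/

namespace MvPolynomial

variable {σ R : Type*} [CommRing R]

/-- A minimal prime of a homogeneous ideal is homogeneous. -/
theorem isHomogeneous_of_mem_minimalPrimes {I P : Ideal (MvPolynomial σ R)}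
    (hI : I.IsHomogeneous (homogeneousSubmodule σ R)) (hP : P ∈ I.minimalPrimes) :
    P.IsHomogeneous (homogeneousSubmodule σ R) := by
  have hle := Ideal.toIdeal_homogeneousCore_le (homogeneousSubmodule σ R) P
  have hprime := hP.1.1.homogeneousCore (𝒜 := homogeneousSubmodule σ R)
  have hI' : I ≤ (P.homogeneousCore (homogeneousSubmodule σ R)).toIdeal := by
    rw [← hI.toIdeal_homogeneousCore_eq_self]
    exact Ideal.homogeneousCore_mono _ hP.1.2
  rw [Ideal.IsHomogeneous.iff_eq]
  exact le_antisymm hle (hP.2 ⟨hprime, hI'⟩ hle)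

theorem exists_isHomogeneous_mem_notMem {P Q : Ideal (MvPolynomial σ R)}
    (hP : P.IsHomogeneous (homogeneousSubmodule σ R)) (h : ¬ P ≤ Q) :
    ∃ (n : ℕ) (f : MvPolynomial σ R), f.IsHomogeneous n ∧ f ∈ P ∧ f ∉ Q := by
  obtain ⟨g, hgP, hgQ⟩ := SetLike.not_le_iff_exists.mp h
  by_contra! hc
  refine hgQ ?_
  rw [← sum_homogeneousComponent g]
  exact sum_mem fun i _ => hc i _ (homogeneousComponent_isHomogeneous i g)
    (homogeneousComponent_mem_of_mem hP hgP i)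

/-- Homogeneous prime avoidance for pairwise incomparable homogeneous primes. -/
theorem exists_isHomogeneous_forall_notMem (T : Finset (Ideal (MvPolynomial σ R)))
    (hT : ∀ P ∈ T, P.IsPrime ∧ P.IsHomogeneous (homogeneousSubmodule σ R) ∧ ∃ i, X i ∉ P)
    (hanti : IsAntichain (· ≤ ·) (T : Set (Ideal (MvPolynomial σ R)))) :
    ∃ (d : ℕ) (f : MvPolynomial σ R), 0 < d ∧ f.IsHomogeneous d ∧ ∀ P ∈ T, f ∉ P := by
  classical
  have key : ∀ P ∈ T, ∃ (d : ℕ) (g : MvPolynomial σ R), 0 < d ∧ g.IsHomogeneous d ∧ g ∉ P ∧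
      ∀ Q ∈ T, Q ≠ P → g ∈ Q := by
    intro P hP
    have h1 : ∀ Q : Ideal (MvPolynomial σ R), ∃ (n : ℕ) (f : MvPolynomial σ R),
        Q ∈ T.erase P → f.IsHomogeneous n ∧ f ∈ Q ∧ f ∉ P := by
      intro Q
      by_cases hQ : Q ∈ T.erase P
      · obtain ⟨hQP, hQT⟩ := Finset.mem_erase.mp hQ
        obtain ⟨n, f, hf⟩ := exists_isHomogeneous_mem_notMem (hT Q hQT).2.1
          (hanti hQT hP hQP)
        exact ⟨n, f, fun _ => hf⟩
      · exact ⟨0, 0, fun h => (hQ h).elim⟩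
    choose n a ha using h1
    obtain ⟨hPp, -, i, hi⟩ := hT P hP
    -- The factor `X i` makes the degree positive even if the product has degree 0.
    refine ⟨1 + ∑ Q ∈ T.erase P, n Q, X i * ∏ Q ∈ T.erase P, a Q, by omega,
      (isHomogeneous_X R i).mul (IsHomogeneous.prod _ _ _ fun Q hQ => (ha Q hQ).1), ?_, ?_⟩
    · intro hmem
      rcases hPp.mem_or_mem hmem with h | h
      · exact hi h
      · obtain ⟨Q, hQ, hQ'⟩ := (hPp.prod_mem_iff).mp h
        exact (ha Q hQ).2.2 hQ'
    · intro Q hQ hQP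
      have hQ' : Q ∈ T.erase P := Finset.mem_erase.mpr ⟨hQP, hQ⟩
      exact Q.mul_mem_left _ (Ideal.mem_of_dvd _ (Finset.dvd_prod_of_mem a hQ') (ha Q hQ').2.1)
  choose! d g hd hg hgP hgQ using key
  have hD : 0 < ∏ P ∈ T, d P := Finset.prod_pos hd
  have hdvd : ∀ P ∈ T, d P * ((∏ P ∈ T, d P) / d P) = ∏ P ∈ T, d P := fun P hP =>
    Nat.mul_div_cancel' (Finset.dvd_prod_of_mem d hP)
  -- Powers bring all `g P` to one common degree; modulo a given `P` only the term of `g P`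
  -- survives.
  refine ⟨∏ P ∈ T, d P, ∑ P ∈ T, g P ^ ((∏ P ∈ T, d P) / d P), hD,
    IsHomogeneous.sum _ _ _ fun P hP => ?_, fun P hP hmem => ?_⟩
  · have := (hg P hP).pow ((∏ P ∈ T, d P) / d P)
    rwa [hdvd P hP] at this
  · rw [← Finset.add_sum_erase T _ hP] at hmem
    have hrest : ∑ Q ∈ T.erase P, g Q ^ ((∏ P ∈ T, d P) / d Q) ∈ P := by
      refine sum_mem fun Q hQ => ?_
      obtain ⟨hQP, hQT⟩ := Finset.mem_erase.mp hQ
      refine P.pow_mem_of_mem (hgQ Q hQT P hP hQP.symm) _ (Nat.pos_of_ne_zero fun h0 => ?_)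
      have := hdvd Q hQT
      rw [h0, mul_zero] at this
      omega
    exact hgP P hP ((hT P hP).1.mem_of_pow_mem _ ((P.add_mem_iff_left hrest).mp hmem))

section IsLocalRing

variable [IsLocalRing R]

variable (σ R) in
/-- The homogeneous maximal ideal of a polynomial ring over a local ring. -/
noncomputable def homogeneousMaximalIdeal : Ideal (MvPolynomial σ R) :=
  (IsLocalRing.maximalIdeal R).comap (constantCoeff (σ := σ) (R := R))

instance : (homogeneousMaximalIdeal σ R).IsMaximal :=
  Ideal.comap_isMaximal_of_surjective _ fun r => ⟨C r, constantCoeff_C σ r⟩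

/-- The constant term of a member of a homogeneous ideal is again a member, hence not a unit if the
ideal is proper. -/
theorem le_homogeneousMaximalIdeal {P : Ideal (MvPolynomial σ R)} (hP : P ≠ ⊤)
    (hhom : P.IsHomogeneous (homogeneousSubmodule σ R)) : P ≤ homogeneousMaximalIdeal σ R := by
  intro f hf
  have h0 := homogeneousComponent_mem_of_mem hhom hf 0
  rw [homogeneousComponent_zero] at h0
  refine (IsLocalRing.mem_maximalIdeal _).mpr fun hu => hP ?_
  exact Ideal.eq_top_of_isUnit_mem _ h0 (hu.map C)

theorem homogeneousMaximalIdeal_le {P : Ideal (MvPolynomial σ R)}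
    (hm : (IsLocalRing.maximalIdeal R).map C ≤ P) (hX : ∀ i, X i ∈ P) :
    homogeneousMaximalIdeal σ R ≤ P := by
  classical
  intro f hf
  rw [← f.support_sum_monomial_coeff]
  refine sum_mem fun d _ => ?_
  rw [monomial_eq]
  by_cases hd : d = 0
  · subst hd
    exact P.mul_mem_right _ (hm (Ideal.mem_map_of_mem C hf))
  · obtain ⟨i, hi⟩ := Finsupp.ne_iff.mp hd
    refine P.mul_mem_left _ (Ideal.mem_of_dvd _ (Finset.dvd_prod_of_mem _
      (Finsupp.mem_support_iff.mpr hi)) (P.pow_mem_of_mem (hX i) _ (Nat.pos_of_ne_zero hi)))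

/-- Homogeneous systems of parameters: if `S / I` has dimension at most `n`, where `I` is a
homogeneous ideal containing the maximal ideal of the coefficients, then some `n` homogeneous
elements of positive degree generate, modulo `I`, an ideal that contains powers of the variables. -/
theorem exists_homogeneous_parameters [IsNoetherianRing R] [Finite σ] (n : ℕ)
    (I : Ideal (MvPolynomial σ R)) (hI : I.IsHomogeneous (homogeneousSubmodule σ R))
    (hm : (IsLocalRing.maximalIdeal R).map C ≤ I)
    (hdim : ringKrullDim (MvPolynomial σ R ⧸ I) ≤ n) :
    ∃ (d : Fin n → ℕ) (f : Fin n → MvPolynomial σ R),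
      (∀ i, 0 < d i ∧ (f i).IsHomogeneous (d i)) ∧
      ∀ i, X i ∈ (I ⊔ Ideal.span (Set.range f)).radical := by
  classical
  induction n generalizing I with
  | zero =>
    refine ⟨finZeroElim, finZeroElim, finZeroElim, fun i => ?_⟩
    rw [Set.range_eq_empty, Ideal.span_empty, sup_bot_eq, ← Ideal.sInf_minimalPrimes,
      Submodule.mem_sInf]
    intro P hP
    have hPle := le_homogeneousMaximalIdeal hP.1.1.ne_top
      (isHomogeneous_of_mem_minimalPrimes hI hP)
    suffices h : P = homogeneousMaximalIdeal σ R by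
      rw [h]
      simp [homogeneousMaximalIdeal]
    by_contra hne
    have hlt := lt_of_le_of_ne hPle hne
    rw [ringKrullDim_quotient] at hdim
    let a : PrimeSpectrum.zeroLocus (I : Set (MvPolynomial σ R)) := ⟨⟨P, hP.1.1⟩, hP.1.2⟩
    let b : PrimeSpectrum.zeroLocus (I : Set (MvPolynomial σ R)) :=
      ⟨⟨homogeneousMaximalIdeal σ R, inferInstance⟩, hP.1.2.trans hPle⟩
    let l : LTSeries (PrimeSpectrum.zeroLocus (I : Set (MvPolynomial σ R))) :=
      (RelSeries.singleton _ b).cons a hlt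
    have h1 := (Order.LTSeries.length_le_krullDim l).trans hdim
    have : l.length = 1 := rfl
    rw [this] at h1
    norm_cast at h1
  | succ n ih =>
    have hfin : I.minimalPrimes.Finite := Ideal.finite_minimalPrimes_of_isNoetherianRing _ I
    -- The homogeneous maximal ideal contains every form of positive degree, so it cannot be avoided
    -- and is left out.
    let T := hfin.toFinset.erase (homogeneousMaximalIdeal σ R)
    have hTmem : ∀ P, P ∈ T ↔ P ≠ homogeneousMaximalIdeal σ R ∧ P ∈ I.minimalPrimes := by
      simp [T]
    obtain ⟨d₀, f₀, hd₀, hf₀, hf₀T⟩ := exists_isHomogeneous_forall_notMem T (fun P hP => by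
      rw [hTmem] at hP
      refine ⟨hP.2.1.1, isHomogeneous_of_mem_minimalPrimes hI hP.2, ?_⟩
      by_contra! hX
      exact hP.1 (le_antisymm (le_homogeneousMaximalIdeal hP.2.1.1.ne_top
        (isHomogeneous_of_mem_minimalPrimes hI hP.2))
        (homogeneousMaximalIdeal_le (hm.trans hP.2.1.2) hX))) (by
      intro P hP Q hQ hne hle
      have hP' := (hTmem P).mp hP
      have hQ' := (hTmem Q).mp hQ
      exact hne (le_antisymm hle (hQ'.2.2 hP'.2.1 hle)))
    have hI₀ : (I ⊔ Ideal.span {f₀}).IsHomogeneous (homogeneousSubmodule σ R) := by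
      refine hI.sup (Ideal.homogeneous_span _ _ ?_)
      rintro x rfl
      exact ⟨d₀, hf₀⟩
    -- The dimension drops: a chain of primes over `I + (f₀)` extends downwards by a minimal prime
    -- of `I` that omits `f₀`. If the minimal prime found is the homogeneous maximal ideal, the
    -- chain has length 0.
    obtain ⟨d, f, hdf, hX⟩ := ih (I ⊔ Ideal.span {f₀}) hI₀ (hm.trans le_sup_left) (by
      rw [ringKrullDim_quotient] at hdim ⊢
      refine iSup_le fun l => ?_
      have hhead := l.head.2
      have hIh : I ≤ l.head.1.asIdeal := le_sup_left.trans hhead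
      obtain ⟨P, hP, hPle⟩ := Ideal.exists_minimalPrimes_le hIh
      let emb : PrimeSpectrum.zeroLocus ((I ⊔ Ideal.span {f₀} : Ideal _) :
          Set (MvPolynomial σ R)) → PrimeSpectrum.zeroLocus (I : Set (MvPolynomial σ R)) :=
        fun x => ⟨x.1, SetLike.coe_subset_coe.mpr (le_sup_left.trans (SetLike.coe_subset_coe.mp x.2))⟩
      by_cases hPM : P = homogeneousMaximalIdeal σ R
      · have hmax : IsMax l.head := by
          intro y hy
          have hy' : l.head.1.asIdeal ≤ y.1.asIdeal := hy
          have : P.IsMaximal := by rw [hPM]; infer_instance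
          have h1 := this.eq_of_le y.1.2.ne_top (hPle.trans hy')
          change y.1.asIdeal ≤ l.head.1.asIdeal
          rw [← h1]
          exact hPle
        have hl : l.length = 0 := by
          by_contra h0
          have : l.head < l.last := l.strictMono (Fin.lt_def.mpr (Nat.pos_of_ne_zero h0))
          exact hmax.not_lt this
        rw [hl]
        exact_mod_cast Nat.zero_le n
      · have hf₀P := hf₀T P ((hTmem P).mpr ⟨hPM, hP⟩)
        have hf₀h : f₀ ∈ l.head.1.asIdeal :=
          hhead (Ideal.mem_sup_right (Ideal.mem_span_singleton_self f₀))
        let a : PrimeSpectrum.zeroLocus (I : Set (MvPolynomial σ R)) := ⟨⟨P, hP.1.1⟩, hP.1.2⟩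
        let l' : LTSeries (PrimeSpectrum.zeroLocus (I : Set (MvPolynomial σ R))) :=
          l.map emb (fun _ _ h => h)
        have ha : a < l'.head := by
          refine lt_of_le_of_ne hPle fun h => hf₀P ?_
          have : P = l.head.1.asIdeal := congrArg (fun x => x.1.asIdeal) h
          rwa [this]
        have h1 := (Order.LTSeries.length_le_krullDim (l'.cons a ha)).trans hdim
        have h2 : (l'.cons a ha).length = l.length + 1 := by simp [l', LTSeries.map]
        rw [h2] at h1
        have h3 : l.length + 1 ≤ n + 1 := by exact_mod_cast h1
        exact_mod_cast Nat.le_of_succ_le_succ h3)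
    refine ⟨Fin.cons d₀ d, Fin.cons f₀ f, Fin.cases ⟨hd₀, hf₀⟩ hdf, fun i => ?_⟩
    rw [Fin.range_cons, Ideal.span_insert, ← sup_assoc]
    exact hX i

end IsLocalRing

end MvPolynomial

/-! ### Rees algebra and fiber cone of an ideal; height versus analytic spread -/

section ReesPresentation

open MvPolynomial

variable {R σ : Type*} [CommRing R] (b : σ → R)

/-- The presentation of the Rees algebra of the ideal generated by `b`, with values in the
polynomial ring. -/
noncomputable def reesPresentation : MvPolynomial σ R →ₐ[R] Polynomial R :=
  aeval fun i => Polynomial.monomial 1 (b i)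

theorem coeff_reesPresentation_mem (f : MvPolynomial σ R) (n : ℕ) :
    (reesPresentation b f).coeff n ∈ Ideal.span (Set.range b) ^ n := by
  suffices h : reesPresentation b f ∈ reesAlgebra (Ideal.span (Set.range b)) from
    (mem_reesAlgebra_iff _ _).mp h n
  induction f using MvPolynomial.induction_on with
  | C a =>
    rw [← algebraMap_eq, AlgHom.commutes]
    exact Subalgebra.algebraMap_mem _ a
  | add p q hp hq =>
    rw [map_add]
    exact add_mem hp hq
  | mul_X p i hp =>
    rw [map_mul]
    refine mul_mem hp ?_
    rw [reesPresentation, aeval_X]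
    exact reesAlgebra.monomial_mem.mpr (by
      rw [pow_one]
      exact Ideal.subset_span ⟨i, rfl⟩)

theorem reesPresentation_of_isHomogeneous {f : MvPolynomial σ R} {d : ℕ} (hf : f.IsHomogeneous d) :
    reesPresentation b f = Polynomial.monomial d (aeval b f) := by
  have hmon : ∀ (m : σ →₀ ℕ) (r : R), reesPresentation b (MvPolynomial.monomial m r) =
      Polynomial.monomial m.degree (aeval b (MvPolynomial.monomial m r)) := by
    intro m r
    rw [reesPresentation, aeval_monomial, aeval_monomial, Polynomial.algebraMap_apply,
      Finsupp.prod, Finsupp.prod]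
    simp only [Polynomial.monomial_pow, one_mul]
    rw [show m.degree = ∑ i ∈ m.support, m i from rfl, ← Polynomial.C_mul_monomial]
    congr 1
    induction m.support using Finset.cons_induction with
    | empty => simp
    | cons a s ha ih => rw [Finset.prod_cons, ih, Polynomial.monomial_mul_monomial,
        Finset.prod_cons, Finset.sum_cons]
  rw [← f.support_sum_monomial_coeff, map_sum, map_sum, map_sum]
  refine Finset.sum_congr rfl fun m hm => ?_
  rw [hmon, hf.degree_eq_sum_deg_support hm]
  rfl

/-- Homogeneous components of different degrees land in different powers of `t`, so their images
cannot cancel. -/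
theorem isHomogeneous_ker_reesPresentation :
    (RingHom.ker (reesPresentation b)).IsHomogeneous (homogeneousSubmodule σ R) := by
  classical
  intro n f hf
  have hcomp : ∀ i, reesPresentation b (homogeneousComponent i f) =
      Polynomial.monomial i (aeval b (homogeneousComponent i f)) := fun i =>
    reesPresentation_of_isHomogeneous b (homogeneousComponent_isHomogeneous i f)
  suffices h : homogeneousComponent n f ∈ RingHom.ker (reesPresentation b) by
    have h1 := decomposition.decompose'_apply f n
    change (decomposition.decompose' f n : MvPolynomial σ R) ∈ _
    rwa [h1]
  rw [RingHom.mem_ker] at hf ⊢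
  rw [hcomp]
  by_cases hn : f.totalDegree < n
  · rw [homogeneousComponent_eq_zero _ _ hn, map_zero, map_zero]
  rw [← sum_homogeneousComponent f, map_sum] at hf
  have := congrArg (fun p => Polynomial.coeff p n) hf
  simp only [hcomp, Polynomial.finsetSum_coeff, Polynomial.coeff_monomial, Polynomial.coeff_zero]
    at this
  rw [Finset.sum_ite_eq' , if_pos (Finset.mem_range.mpr (by omega))] at this
  rw [this, map_zero]

theorem exists_mem_pow_reesPresentation_eq {n : ℕ} {x : R}
    (hx : x ∈ Ideal.span (Set.range b) ^ n) :
    ∃ s ∈ Ideal.span (Set.range (X : σ → MvPolynomial σ R)) ^ n,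
      reesPresentation b s = Polynomial.monomial n x := by
  induction n generalizing x with
  | zero =>
    refine ⟨C x, by simp, ?_⟩
    rw [← algebraMap_eq, AlgHom.commutes]
    rfl
  | succ n ih =>
    rw [pow_succ] at hx
    induction hx using Submodule.mul_induction_on' with
    | mem_mul_mem y hy z hz =>
      obtain ⟨s, hs, hsy⟩ := ih hy
      have : ∃ t ∈ Ideal.span (Set.range (X : σ → MvPolynomial σ R)),
          reesPresentation b t = Polynomial.monomial 1 z := by
        clear hs hsy hy
        induction hz using Submodule.span_induction with
        | mem _ h =>
          obtain ⟨i, rfl⟩ := h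
          exact ⟨X i, Ideal.subset_span ⟨i, rfl⟩, by rw [reesPresentation, aeval_X]⟩
        | zero => exact ⟨0, zero_mem _, by simp⟩
        | add p q _ _ hp hq =>
          obtain ⟨s, hs, hs'⟩ := hp
          obtain ⟨t, ht, ht'⟩ := hq
          exact ⟨s + t, add_mem hs ht, by rw [map_add, hs', ht', map_add]⟩
        | smul r p _ hp =>
          obtain ⟨s, hs, hs'⟩ := hp
          refine ⟨r • s, Submodule.smul_of_tower_mem _ r hs, ?_⟩
          rw [map_smul, hs', Polynomial.smul_monomial]
      obtain ⟨t, ht, htz⟩ := this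
      refine ⟨s * t, ?_, ?_⟩
      · rw [pow_succ]
        exact Ideal.mul_mem_mul hs ht
      · rw [map_mul, hsy, htz, Polynomial.monomial_mul_monomial]
    | add p _ q _ hp hq =>
      obtain ⟨s, hs, hs'⟩ := hp
      obtain ⟨t, ht, ht'⟩ := hq
      exact ⟨s + t, add_mem hs ht, by rw [map_add, hs', ht', map_add]⟩

/-- The ideal of relations of the fiber cone of the ideal generated by `b`. -/
noncomputable def fiberRelations [IsLocalRing R] : Ideal (MvPolynomial σ R) :=
  RingHom.ker (reesPresentation b) ⊔ (IsLocalRing.maximalIdeal R).map C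

theorem isHomogeneous_fiberRelations [IsLocalRing R] :
    (fiberRelations b).IsHomogeneous (homogeneousSubmodule σ R) := by
  refine (isHomogeneous_ker_reesPresentation b).sup (Ideal.homogeneous_span _ _ ?_)
  rintro _ ⟨r, -, rfl⟩
  exact ⟨0, isHomogeneous_C σ r⟩

/-- With `m` maximal, this supplies the error term `m * J ^ N` for Nakayama. -/
theorem coeff_reesPresentation_mem_of_mem_map (m : Ideal R) {f : MvPolynomial σ R}
    (hf : f ∈ m.map C) (n : ℕ) :
    (reesPresentation b f).coeff n ∈ m * Ideal.span (Set.range b) ^ n := by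
  induction hf using Submodule.span_induction generalizing n with
  | mem _ h =>
    obtain ⟨r, hr, rfl⟩ := h
    rw [← algebraMap_eq, AlgHom.commutes, Polynomial.algebraMap_apply, Polynomial.coeff_C]
    split_ifs with h0
    · subst h0
      simpa using hr
    · exact zero_mem _
  | zero => simp
  | add p q _ _ hp hq =>
    rw [map_add, Polynomial.coeff_add]
    exact add_mem (hp n) (hq n)
  | smul g p _ hp =>
    rw [smul_eq_mul, map_mul, Polynomial.coeff_mul]
    refine sum_mem fun ij hij => ?_
    rw [← Finset.HasAntidiagonal.mem_antidiagonal.mp hij, pow_add, mul_left_comm]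
    exact Ideal.mul_mem_mul (coeff_reesPresentation_mem b g _) (hp _)

/-- The height of a proper ideal in a Noetherian local ring is at most its analytic spread, the
dimension of its fiber cone. -/
theorem height_span_range_le_ringKrullDim_fiber [IsLocalRing R] [IsNoetherianRing R] [Finite σ]
    (hb : Ideal.span (Set.range b) ≠ ⊤) :
    ((Ideal.span (Set.range b)).height : WithBot ℕ∞) ≤
      ringKrullDim (MvPolynomial σ R ⧸ fiberRelations b) := by
  have hnt : Nontrivial (MvPolynomial σ R ⧸ fiberRelations b) := by
    refine Ideal.Quotient.nontrivial_iff.mpr fun htop => ?_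
    have h1 : (1 : MvPolynomial σ R) ∈ fiberRelations b := htop ▸ Submodule.mem_top
    obtain ⟨u, hu, w, hw, huw⟩ := Submodule.mem_sup.mp h1
    have h2 := coeff_reesPresentation_mem_of_mem_map b _ hw 0
    rw [pow_zero, mul_one] at h2
    have h3 : reesPresentation b w = 1 := by
      rw [← map_one (reesPresentation b), ← huw, map_add, RingHom.mem_ker.mp hu, zero_add]
    rw [h3, Polynomial.coeff_one_zero] at h2
    exact (Ideal.ne_top_iff_one _).mp (IsLocalRing.maximalIdeal.isMaximal R).ne_top h2
  have h0 := ringKrullDim_nonneg_of_nontrivial (R := MvPolynomial σ R ⧸ fiberRelations b)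
  by_cases htop : ringKrullDim (MvPolynomial σ R ⧸ fiberRelations b) = ⊤
  · rw [htop]
    exact le_top
  obtain ⟨n, hn⟩ : ∃ n : ℕ, ringKrullDim (MvPolynomial σ R ⧸ fiberRelations b) = n := by
    generalize ringKrullDim (MvPolynomial σ R ⧸ fiberRelations b) = k at h0 htop
    induction k with
    | bot => simp at h0
    | coe k =>
      induction k with
      | top => exact (htop rfl).elim
      | coe k => exact ⟨k, rfl⟩
  obtain ⟨d, f, hf, hX⟩ := exists_homogeneous_parameters n (fiberRelations b)
    (isHomogeneous_fiberRelations b) le_sup_right hn.le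
  let a : Fin n → R := fun i => aeval b (f i)
  have hfa : ∀ i, reesPresentation b (f i) = Polynomial.monomial (d i) (a i) := fun i =>
    reesPresentation_of_isHomogeneous b (hf i).2
  have haI : ∀ i, a i ∈ Ideal.span (Set.range b) := by
    intro i
    have := coeff_reesPresentation_mem b (f i) (d i)
    rw [hfa, Polynomial.coeff_monomial_same] at this
    exact Ideal.pow_le_self (hf i).1.ne' this
  obtain ⟨N, hN⟩ := Ideal.exists_pow_le_of_le_radical_of_fg
    (I := Ideal.span (Set.range (X : σ → MvPolynomial σ R)))
    (Ideal.span_le.mpr (by rintro _ ⟨i, rfl⟩; exact hX i)) (IsNoetherian.noetherian _)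
  -- In degree `N` the kernel contributes nothing, the extension of the maximal ideal contributes `m
  -- * J ^ N`, and multiples of `f i` contribute multiples of `a i`.
  have hcoeff : ∀ u ∈ fiberRelations b ⊔ Ideal.span (Set.range f),
      (reesPresentation b u).coeff N ∈ Ideal.span (Set.range a) ⊔
        IsLocalRing.maximalIdeal R * Ideal.span (Set.range b) ^ N := by
    intro u hu
    obtain ⟨w, hw, z, hz, rfl⟩ := Submodule.mem_sup.mp hu
    obtain ⟨w₁, hw₁, w₂, hw₂, rfl⟩ := Submodule.mem_sup.mp hw
    rw [map_add, map_add, RingHom.mem_ker.mp hw₁, zero_add, Polynomial.coeff_add]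
    refine add_mem (Ideal.mem_sup_right (coeff_reesPresentation_mem_of_mem_map b _ hw₂ N))
      (Ideal.mem_sup_left ?_)
    obtain ⟨c, rfl⟩ := (Ideal.mem_span_range_iff_exists_fun).mp hz
    rw [map_sum, Polynomial.finsetSum_coeff]
    refine sum_mem fun i _ => ?_
    rw [map_mul, hfa, Polynomial.coeff_mul]
    refine sum_mem fun jk _ => Ideal.mul_mem_left _ _ ?_
    rw [Polynomial.coeff_monomial]
    split_ifs
    · exact Ideal.subset_span ⟨i, rfl⟩
    · exact zero_mem _
  have hpow : Ideal.span (Set.range b) ^ N ≤ Ideal.span (Set.range a) := by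
    -- Nakayama, applied to `J ^ N ⊆ (a) + m * J ^ N`.
    refine Submodule.le_of_le_smul_of_le_jacobson_bot (I := IsLocalRing.maximalIdeal R)
      (IsNoetherian.noetherian _) (IsLocalRing.maximalIdeal_le_jacobson _) fun x hx => ?_
    obtain ⟨s, hs, hsx⟩ := exists_mem_pow_reesPresentation_eq b hx
    have := hcoeff s (hN hs)
    rwa [hsx, Polynomial.coeff_monomial_same] at this
  have hle : Ideal.span (Set.range a) ≤ Ideal.span (Set.range b) :=
    Ideal.span_le.mpr (by rintro _ ⟨i, rfl⟩; exact haI i)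
  have hrad : (Ideal.span (Set.range b)).height ≤ (Ideal.span (Set.range a)).height := by
    have h1 : (Ideal.span (Set.range a)).radical.height = (Ideal.span (Set.range a)).height := by
      rw [Ideal.height_eq_inf_minimalPrimes, Ideal.height_eq_inf_minimalPrimes,
        Ideal.radical_minimalPrimes]
    rw [← h1]
    exact Ideal.height_mono fun x hx => ⟨N, hpow (Ideal.pow_mem_pow hx N)⟩
  have hKrull := Ideal.height_le_spanFinrank (Ideal.span (Set.range a)) (ne_top_of_le_ne_top hb hle)
  have hrank : (Ideal.span (Set.range a)).spanFinrank ≤ n := by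
    refine (Submodule.spanFinrank_span_le_ncard_of_finite (Set.finite_range a)).trans ?_
    rw [← Nat.card_coe_set_eq]
    exact (Finite.card_range_le a).trans (by simp)
  rw [hn]
  exact_mod_cast hrad.trans (hKrull.trans (by exact_mod_cast hrank))

end ReesPresentation

/-! ### From a linear form on a module to its analytic spread -/

section FiberCone

open MvPolynomial

variable {R : Type u} [CommRing R] {M : Type v} [AddCommGroup M] [Module R M]

/-- A non-zero-divisor of `R` acts injectively on `R[t]`, coefficient by coefficient. -/
theorem torsionIdeal_le_ker_lift_monomial (p : M →ₗ[R] R) :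
    torsionIdeal R (SymmetricAlgebra R M) ≤
      RingHom.ker (SymmetricAlgebra.lift ((Polynomial.monomial 1).comp p)) := by
  rintro x ⟨⟨r, hr⟩, hx⟩
  rw [RingHom.mem_ker]
  have h1 : r • SymmetricAlgebra.lift ((Polynomial.monomial 1).comp p) x = 0 := by
    rw [← map_smul, show r • x = 0 from hx, map_zero]
  ext n
  have h2 := congrArg (fun q => Polynomial.coeff q n) h1
  simp only [Polynomial.coeff_smul, smul_eq_mul, Polynomial.coeff_zero] at h2
  rw [Polynomial.coeff_zero]
  exact (mul_left_mem_nonZeroDivisors_eq_zero_iff hr).mp h2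

/-- If a finite module over a Noetherian local ring maps onto a proper ideal, then the height of
that ideal is at most the analytic spread of the module. -/
theorem height_range_le_analyticSpread [IsNoetherianRing R] [IsLocalRing R] [Module.Finite R M]
    (p : M →ₗ[R] R) (hp : LinearMap.range p ≠ ⊤) :
    (Ideal.height (LinearMap.range p) : WithBot ℕ∞) ≤ analyticSpread R M := by
  obtain ⟨n, w, hw⟩ := Module.Finite.exists_fin (R := R) (M := M)
  have hrange : LinearMap.range p = Ideal.span (Set.range fun i => p (w i)) := by
    rw [LinearMap.range_eq_map, ← hw, Submodule.map_span, ← Set.range_comp]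
    rfl
  rw [hrange] at hp ⊢
  refine (height_span_range_le_ringKrullDim_fiber _ hp).trans ?_
  let τ : MvPolynomial (Fin n) R →ₐ[R] SymmetricAlgebra R M :=
    aeval fun i => SymmetricAlgebra.ι R M (w i)
  have hτ : Function.Surjective τ := by
    intro x
    induction x using SymmetricAlgebra.induction with
    | algebraMap r => exact ⟨C r, by rw [← algebraMap_eq, AlgHom.commutes]⟩
    | ι x =>
      have hx : x ∈ Submodule.span R (Set.range w) := hw ▸ Submodule.mem_top
      obtain ⟨c, rfl⟩ := (Submodule.mem_span_range_iff_exists_fun R).mp hx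
      exact ⟨∑ i, c i • X i, by simp [τ]⟩
    | mul a b ha hb =>
      obtain ⟨s, rfl⟩ := ha
      obtain ⟨t, rfl⟩ := hb
      exact ⟨s * t, map_mul _ _ _⟩
    | add a b ha hb =>
      obtain ⟨s, rfl⟩ := ha
      obtain ⟨t, rfl⟩ := hb
      exact ⟨s + t, map_add _ _ _⟩
  let ρ : MvPolynomial (Fin n) R →ₐ[R] ModuleReesAlgebra R M :=
    (Ideal.Quotient.mkₐ R (torsionIdeal R (SymmetricAlgebra R M))).comp τ
  have hρ : Function.Surjective ρ := Ideal.Quotient.mk_surjective.comp hτ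
  have hρker : RingHom.ker ρ ≤ RingHom.ker (reesPresentation fun i => p (w i)) := by
    intro s hs
    have h1 : τ s ∈ torsionIdeal R (SymmetricAlgebra R M) := Ideal.Quotient.eq_zero_iff_mem.mp hs
    have h2 := torsionIdeal_le_ker_lift_monomial p h1
    have h3 : (SymmetricAlgebra.lift ((Polynomial.monomial 1).comp p)).comp τ =
        reesPresentation fun i => p (w i) := by
      ext i : 1
      simp [τ, reesPresentation]
    rw [RingHom.mem_ker, ← h3]
    exact h2
  let J : Ideal (ModuleReesAlgebra R M) :=
    (IsLocalRing.maximalIdeal R).map (algebraMap R (ModuleReesAlgebra R M))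
  let q : MvPolynomial (Fin n) R →+* ModuleReesAlgebra R M ⧸ J :=
    (Ideal.Quotient.mk J).comp (ρ : MvPolynomial (Fin n) R →+* ModuleReesAlgebra R M)
  have hq : Function.Surjective q := Ideal.Quotient.mk_surjective.comp hρ
  -- The kernel of the presentation of the fiber cone of `M` lies in the relations of that of the
  -- ideal, so the former maps onto the latter.
  have hker : RingHom.ker q ≤ fiberRelations fun i => p (w i) := by
    intro s hs
    have h1 : ρ s ∈ J := Ideal.Quotient.eq_zero_iff_mem.mp hs
    have h2 : J = ((IsLocalRing.maximalIdeal R).map C).map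
        (ρ : MvPolynomial (Fin n) R →+* ModuleReesAlgebra R M) := by
      rw [Ideal.map_map, ← algebraMap_eq]
      exact congrArg (fun g => Ideal.map g _) ρ.comp_algebraMap.symm
    rw [h2] at h1
    obtain ⟨t, ht, hts⟩ := (Ideal.mem_map_iff_of_surjective _ hρ).mp h1
    have h3 : s - t ∈ RingHom.ker ρ := by
      rw [RingHom.mem_ker, map_sub, sub_eq_zero]
      exact hts.symm
    rw [← sub_add_cancel s t]
    exact add_mem (Ideal.mem_sup_left (hρker h3)) (Ideal.mem_sup_right ht)
  have h4 : analyticSpread R M = ringKrullDim (MvPolynomial (Fin n) R ⧸ RingHom.ker q) := by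
    rw [analyticSpread, ringKrullDim_eq_of_ringEquiv (RingHom.quotientKerEquivOfSurjective hq)]
    exact (ringKrullDim_eq_of_ringEquiv (Algebra.TensorProduct.quotIdealMapEquivTensorQuot
      (ModuleReesAlgebra R M) (IsLocalRing.maximalIdeal R)).toRingEquiv).symm
  rw [h4]
  exact ringKrullDim_le_of_surjective _ (Ideal.Quotient.factor_surjective hker)

end FiberCone

/-! ### Projective dimension and syzygies -/

section ProjectiveDimension

open CategoryTheory

/-- The kernel of a map from a finite free module onto a module of projective dimension at most one
is projective. -/
theorem projective_ker_of_projectiveDimension_le_one {R : Type u} [CommRing R] [Small.{v} R]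
    {E : Type v} [AddCommGroup E] [Module R E] {n : ℕ} (π : (Fin n → R) →ₗ[R] E)
    (hπ : Function.Surjective π) (hpd : projectiveDimension (ModuleCat.of R E) ≤ 1) :
    Module.Projective R (LinearMap.ker π) := by
  -- A copy of `R` in the universe of `E` puts the whole exact sequence in one module category.
  let ε : (Fin n → Shrink.{v} R) ≃ₗ[R] (Fin n → R) :=
    LinearEquiv.piCongrRight fun _ => Shrink.linearEquiv R R
  let ρ : (Fin n → Shrink.{v} R) →ₗ[R] E := π ∘ₗ ε.toLinearMap
  have hρ : Function.Surjective ρ := hπ.comp ε.surjective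
  let S : ShortComplex (ModuleCat.{v} R) := ShortComplex.mk
    (ModuleCat.ofHom (LinearMap.ker ρ).subtype) (ModuleCat.ofHom ρ) (by ext x; exact x.2)
  have hS : S.ShortExact :=
    { exact := (ShortComplex.ShortExact.moduleCat_exact_iff_function_exact S).mpr
        (LinearMap.exact_subtype_ker_map ρ)
      mono_f := (ModuleCat.mono_iff_injective _).mpr (Submodule.injective_subtype _)
      epi_g := (ModuleCat.epi_iff_surjective _).mpr hρ }
  have h₂ : Projective S.X₂ := by
    have : Module.Projective R (Fin n → Shrink.{v} R) := Module.Projective.of_equiv ε.symm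
    exact (IsProjective.iff_projective _).mp this
  have h₃ : HasProjectiveDimensionLT S.X₃ 2 := (projectiveDimension_le_iff _ 1).mp hpd
  have h₁ := (hS.hasProjectiveDimensionLT_X₃_iff 0 h₂).mp h₃
  have h₁' := projective_iff_hasProjectiveDimensionLT_one.mpr h₁
  have hker : Module.Projective R (LinearMap.ker ρ) := (IsProjective.iff_projective _).mpr h₁'
  refine Module.Projective.of_equiv (ε.ofSubmodules _ _ ?_ : LinearMap.ker ρ ≃ₗ[R] LinearMap.ker π)
  rw [LinearMap.ker_comp, Submodule.map_comap_eq_of_surjective ε.surjective]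

theorem projectiveDimension_le_zero_of_projective {R : Type u} [CommRing R] [Small.{v} R]
    {E : Type v} [AddCommGroup E] [Module R E] [Module.Projective R E] :
    projectiveDimension (ModuleCat.of R E) ≤ 0 := by
  have h : Projective (ModuleCat.of R E) := (IsProjective.iff_projective E).mp ‹_›
  exact (projectiveDimension_le_iff _ 0).mpr (projective_iff_hasProjectiveDimensionLT_one.mp h)

end ProjectiveDimension

/-! ### Additivity of rank -/

section Rank

/-- Additivity of the rank along `0 → ker π → R ^ n → E → 0` with free kernel. -/
theorem finrank_ker_add_rank {R : Type*} [CommRing R] [Nontrivial R] {E : Type*} [AddCommGroup E]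
    [Module R E] {e n : ℕ} (hrank : HasModuleRank R E e) (π : (Fin n → R) →ₗ[R] E)
    (hπ : Function.Surjective π) [Module.Free R (LinearMap.ker π)]
    [Module.Finite R (LinearMap.ker π)] :
    e + Module.finrank R (LinearMap.ker π) = n := by
  obtain ⟨θ⟩ := hrank
  let Q := FractionRing R
  let f : Q ⊗[R] LinearMap.ker π →ₗ[Q] Q ⊗[R] (Fin n → R) :=
    (LinearMap.ker π).subtype.baseChange Q
  let g : Q ⊗[R] (Fin n → R) →ₗ[Q] Q ⊗[R] E := π.baseChange Q
  have : Module.Flat R Q := IsLocalization.flat Q (nonZeroDivisors R)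
  have hf : Function.Injective f :=
    Module.Flat.lTensor_preserves_injective_linearMap _ (Submodule.injective_subtype _)
  have hfg : Function.Exact f g := lTensor_exact Q (LinearMap.exact_subtype_ker_map π) hπ
  have hg : Function.Surjective g := LinearMap.lTensor_surjective Q hπ
  have hfree : Module.Free Q (Q ⊗[R] E) := Module.Free.of_equiv θ.symm
  have hfin : Module.Finite Q (Q ⊗[R] E) := Module.Finite.equiv θ.symm
  -- `Q` need not be a field, but the localized sequence splits because `Q ⊗ E` is free.
  obtain ⟨l, hl⟩ := Module.projective_lifting_property g LinearMap.id hg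
  have hsplit := (hfg.splitSurjectiveEquiv hf ⟨l, hl⟩).1.finrank_eq
  rw [Module.finrank_prod, Module.finrank_baseChange, Module.finrank_baseChange, θ.finrank_eq,
    Module.finrank_fin_fun, Module.finrank_fin_fun] at hsplit
  omega

end Rank

/-! ### The determinantal linear form on the exterior power -/

section WedgeDet

variable {R : Type*} [CommRing R] {V E κ : Type*} [AddCommGroup V] [Module R V] [AddCommGroup E]
  [Module R E] [Fintype κ] [DecidableEq κ] {e : ℕ} (b : Module.Basis (Fin e ⊕ κ) R V)
  (π : V →ₗ[R] E) (ψ : κ → V)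

variable {π ψ} in
-- Each `v i` changes by a combination of the columns `ψ`, a unipotent column operation.
theorem det_sumElim_congr (hψ : Submodule.span R (Set.range ψ) = LinearMap.ker π) {v v' : Fin e → V}
    (h : ∀ i, π (v i) = π (v' i)) : b.det (Sum.elim v ψ) = b.det (Sum.elim v' ψ) := by
  have h1 : ∀ i, ∃ c : κ → R, v i = v' i + ∑ j, c j • ψ j := by
    intro i
    have : v i - v' i ∈ Submodule.span R (Set.range ψ) := by
      rw [hψ, LinearMap.mem_ker, map_sub, h, sub_self]
    obtain ⟨c, hc⟩ := (Submodule.mem_span_range_iff_exists_fun R).mp this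
    exact ⟨c, by rw [hc, add_sub_cancel]⟩
  choose c hc using h1
  have h2 : b.toMatrix (Sum.elim v ψ) = b.toMatrix (Sum.elim v' ψ) *
      Matrix.fromBlocks 1 0 (Matrix.of fun j i => c i j) 1 := by
    ext i j
    rcases j with j | j
    · simp [Matrix.mul_apply, Module.Basis.toMatrix_apply, hc, Matrix.one_apply, mul_comm]
    · simp [Matrix.mul_apply, Module.Basis.toMatrix_apply, Matrix.one_apply]
  rw [Module.Basis.det_apply, Module.Basis.det_apply, h2, Matrix.det_mul,
    Matrix.det_fromBlocks_zero₁₂, Matrix.det_one, Matrix.det_one, mul_one, mul_one]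

variable {π ψ}

theorem det_sumElim_update (hπ : Function.Surjective π)
    (hψ : Submodule.span R (Set.range ψ) = LinearMap.ker π) (x : Fin e → E) (i : Fin e) (y : V) :
    b.det (Sum.elim (fun j => Function.surjInv hπ (Function.update x i (π y) j)) ψ) =
      b.det (Function.update (Sum.elim (fun j => Function.surjInv hπ (x j)) ψ) (Sum.inl i) y) := by
  rw [Sum.update_elim_inl]
  refine det_sumElim_congr b hψ fun j => ?_
  rw [Function.surjInv_eq hπ]
  by_cases hj : j = i
  · subst hj
    rw [Function.update_self, Function.update_self]
  · rw [Function.update_of_ne hj, Function.update_of_ne hj, Function.surjInv_eq hπ]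

/-- If `ψ` generates the kernel of the surjection `π : V → E`, then
`(π v₁, …, π vₑ) ↦ det (v₁, …, vₑ, ψ)` is an alternating form on `E`. -/
noncomputable def quotientDet (hπ : Function.Surjective π)
    (hψ : Submodule.span R (Set.range ψ) = LinearMap.ker π) : E [⋀^Fin e]→ₗ[R] R where
  toFun x := b.det (Sum.elim (fun i => Function.surjInv hπ (x i)) ψ)
  map_update_add' := by
    intro inst x i y z
    cases Subsingleton.elim inst (instDecidableEqFin e)
    obtain ⟨y, rfl⟩ := hπ y
    obtain ⟨z, rfl⟩ := hπ z
    rw [← map_add, det_sumElim_update, det_sumElim_update, det_sumElim_update,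
      AlternatingMap.map_update_add] <;> exact hψ
  map_update_smul' := by
    intro inst x i r y
    cases Subsingleton.elim inst (instDecidableEqFin e)
    obtain ⟨y, rfl⟩ := hπ y
    rw [← map_smul, det_sumElim_update, det_sumElim_update,
      AlternatingMap.map_update_smul] <;> exact hψ
  map_eq_zero_of_eq' x i j hij hne := by
    refine b.det.map_eq_zero_of_eq _ (i := Sum.inl i) (j := Sum.inl j) ?_ (by simpa using hne)
    rw [Sum.elim_inl, Sum.elim_inl, hij]

/-- The linear form on the exterior power of `E` induced by `quotientDet`. -/
noncomputable def wedgeDet (hπ : Function.Surjective π)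
    (hψ : Submodule.span R (Set.range ψ) = LinearMap.ker π) : ⋀[R]^e E →ₗ[R] R :=
  exteriorPower.alternatingMapLinearEquiv (quotientDet b hπ hψ)

theorem wedgeDet_ιMulti (hπ : Function.Surjective π)
    (hψ : Submodule.span R (Set.range ψ) = LinearMap.ker π) (v : Fin e → V) :
    wedgeDet b hπ hψ (exteriorPower.ιMulti R e fun i => π (v i)) = b.det (Sum.elim v ψ) := by
  rw [wedgeDet, exteriorPower.alternatingMapLinearEquiv_apply_ιMulti]
  exact det_sumElim_congr b hψ fun i => Function.surjInv_eq hπ _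

/-- If the linear form `wedgeDet` is surjective over a local ring, then `E` is free. -/
theorem free_of_range_wedgeDet_eq_top [IsLocalRing R] (hπ : Function.Surjective π)
    (hψ : Submodule.span R (Set.range ψ) = LinearMap.ker π)
    (htop : LinearMap.range (wedgeDet b hπ hψ) = ⊤) : Module.Free R E := by
  -- Decomposable wedges span and `R` is local, so one of them already takes a unit value.
  have h1 : ∃ x : Fin e → E, IsUnit (wedgeDet b hπ hψ (exteriorPower.ιMulti R e x)) := by
    by_contra! hc
    have hle : LinearMap.range (wedgeDet b hπ hψ) ≤ IsLocalRing.maximalIdeal R := by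
      rw [LinearMap.range_eq_map, ← exteriorPower.ιMulti_span, Submodule.map_span,
        Submodule.span_le]
      rintro _ ⟨_, ⟨x, rfl⟩, rfl⟩
      exact (IsLocalRing.mem_maximalIdeal _).mpr (hc x)
    rw [htop, top_le_iff] at hle
    exact (IsLocalRing.maximalIdeal.isMaximal R).ne_top hle
  obtain ⟨x, hx⟩ := h1
  obtain ⟨v, rfl⟩ : ∃ v : Fin e → V, (fun i => π (v i)) = x :=
    ⟨fun i => Function.surjInv hπ (x i), funext fun i => Function.surjInv_eq hπ _⟩
  -- A unit determinant means that `v` and `ψ` together form a basis; modulo the span of `ψ`, the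
  -- images of `v` form a basis of `E`.
  rw [wedgeDet_ιMulti, ← Module.Basis.is_basis_iff_det, linearIndependent_sum] at hx
  obtain ⟨⟨hv, -, hdisj⟩, hspan⟩ := hx
  simp only [Sum.elim_comp_inl, Sum.elim_comp_inr] at hv hdisj
  refine Module.Free.of_basis (Module.Basis.mk (v := π ∘ v) (hv.map (hψ ▸ hdisj)) ?_)
  rw [Set.Sum.elim_range, Submodule.span_union, hψ] at hspan
  have h2 := congrArg (Submodule.map π) hspan
  rw [Submodule.map_sup, Submodule.map_top, LinearMap.range_eq_top.mpr hπ] at h2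
  have h3 : Submodule.map π (LinearMap.ker π) = ⊥ := by
    rw [eq_bot_iff, Submodule.map_le_iff_le_comap]
    exact le_rfl
  rw [h3, sup_bot_eq, Submodule.map_span, ← Set.range_comp] at h2
  exact h2.ge

end WedgeDet

/-! ### Fitting minors as values of the form -/

section Minors

variable {R : Type*} [CommRing R] {E : Type*} [AddCommGroup E] [Module R E] {e k n : ℕ}
  (b : Module.Basis (Fin e ⊕ Fin k) R (Fin n → R)) {π : (Fin n → R) →ₗ[R] E}
  {ψ : Fin k → Fin n → R}

/-- The maximal minors of a matrix whose columns generate the kernel of `π` are values of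
`wedgeDet`. -/
theorem det_submatrix_mem_range_wedgeDet [Nontrivial R] (hπ : Function.Surjective π)
    (hψ : Submodule.span R (Set.range ψ) = LinearMap.ker π) (r : Fin k → Fin n) :
    (Matrix.of fun i j => ψ j (r i)).det ∈ LinearMap.range (wedgeDet b hπ hψ) := by
  by_cases hr : Function.Injective r
  · have hn : e + k = n := by
      have := Module.finrank_eq_card_basis b
      simpa using this.symm
    have hcard : Fintype.card (Fin e) = Fintype.card {x : Fin n // x ∉ Set.range r} := by
      classical
      rw [Fintype.card_subtype_compl, Fintype.card_fin, Fintype.card_fin,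
        show Fintype.card {x // x ∈ Set.range r} = k by
          exact (Fintype.card_congr (Equiv.ofInjective r hr)).symm.trans (Fintype.card_fin k)]
      omega
    let s : Fin e ≃ {x : Fin n // x ∉ Set.range r} := Fintype.equivOfCardEq hcard
    let q : Fin e ⊕ Fin k ≃ Fin n := Equiv.ofBijective (Sum.elim (fun i => (s i).1) r) (by
      rw [Fintype.bijective_iff_injective_and_card]
      refine ⟨Function.Injective.sumElim (Subtype.val_injective.comp s.injective) hr
        fun i j h => (s i).2 ⟨j, h.symm⟩, by simp [hn]⟩)
    let b' := (Pi.basisFun R (Fin n)).reindex q.symm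
    -- Standard basis vectors at the rows outside `r` make the matrix block triangular, leaving the
    -- minor on the rows `r`.
    let v : Fin e → Fin n → R := fun i => Pi.single (s i).1 1
    have hmat : b'.toMatrix (Sum.elim v ψ) = Matrix.fromBlocks 1
        (Matrix.of fun i j => ψ j (s i).1) 0 (Matrix.of fun i j => ψ j (r i)) := by
      ext i j
      have hrepr : ∀ w : Fin n → R, b'.repr w i = w (q i) := fun w => by simp [b']
      rw [Module.Basis.toMatrix_apply, hrepr]
      rcases i with i | i <;> rcases j with j | j
      · simp [q, v, Pi.single_apply, Matrix.one_apply, Subtype.val_inj]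
      · simp [q]
      · have : r i ≠ (s j).1 := fun h => (s j).2 ⟨i, h⟩
        simp [q, v, this]
      · simp [q]
    have hdet : b'.det (Sum.elim v ψ) = (Matrix.of fun i j => ψ j (r i)).det := by
      rw [Module.Basis.det_apply, hmat, Matrix.det_fromBlocks_zero₂₁, Matrix.det_one, one_mul]
    rw [← hdet, AlternatingMap.eq_smul_basis_det b b'.det, AlternatingMap.smul_apply,
      ← wedgeDet_ιMulti b hπ hψ]
    exact Submodule.smul_mem _ _ ⟨_, rfl⟩
  · obtain ⟨i, j, hij, hne⟩ := Function.not_injective_iff.mp hr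
    rw [Matrix.det_zero_of_row_eq hne (by ext l; simp [hij])]
    exact zero_mem _

theorem minorsIdeal_le_range_wedgeDet [Nontrivial R] (hπ : Function.Surjective π)
    (hψ : Submodule.span R (Set.range ψ) = LinearMap.ker π) {m : ℕ}
    (φ : Matrix (Fin n) (Fin m) R) (hφ : Function.Exact φ.mulVecLin π) :
    minorsIdeal φ k ≤ LinearMap.range (wedgeDet b hπ hψ) := by
  refine Ideal.span_le.mpr ?_
  rintro _ ⟨r, c, rfl⟩
  have h1 : ∀ j, ∃ a : Fin k → R, ∑ l, a l • ψ l = φ.col j := by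
    intro j
    refine (Submodule.mem_span_range_iff_exists_fun R).mp ?_
    rw [hψ, LinearMap.mem_ker]
    exact (hφ _).mpr ⟨Pi.single j 1, by simp⟩
  choose a ha using h1
  -- As `ψ` has exactly `k` columns, both factors are square and the determinant is multiplicative.
  have h2 : φ.submatrix r c = (Matrix.of fun i j => ψ j (r i)) * Matrix.of fun l j => a (c j) l := by
    ext i j
    have := congrFun (ha (c j)) (r i)
    rw [Finset.sum_apply] at this
    simpa [Matrix.mul_apply, mul_comm] using this.symm
  rw [h2, Matrix.det_mul, mul_comm]
  exact Submodule.smul_mem _ _ (det_submatrix_mem_range_wedgeDet b hπ hψ r)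

end Minors

/-! ### The inequality -/

theorem corollary2p5 {R : Type u} [CommRing R] [IsNoetherianRing R] [IsLocalRing R]
    [Small.{v} R] {E : Type v} [AddCommGroup E] [Module R E] [Module.Finite R E]
    (e : ℕ) (hrank : HasModuleRank R E e)
    (hpd : CategoryTheory.projectiveDimension (ModuleCat.of R E) = 1)
    (I : Ideal R) (hI : IsFittingIdeal R E e I) :
    (I.height : WithBot ℕ∞) ≤ analyticSpread R (⋀[R]^e E) := by
  obtain ⟨n, m, φ, π, ⟨hφ, hπ⟩, rfl⟩ := hI
  have hproj := projective_ker_of_projectiveDimension_le_one π hπ hpd.le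
  have hfree : Module.Free R (LinearMap.ker π) := Module.free_of_flat_of_isLocalRing
  have hn := finrank_ker_add_rank hrank π hπ
  generalize hk : Module.finrank R (LinearMap.ker π) = k at hn
  obtain rfl : n - e = k := by omega
  let β : Module.Basis (Fin (n - e)) R (LinearMap.ker π) := Module.finBasisOfFinrankEq R _ hk
  let ψ : Fin (n - e) → Fin n → R := fun j => (β j).1
  have hψ : Submodule.span R (Set.range ψ) = LinearMap.ker π := by
    have h1 := congrArg (Submodule.map (LinearMap.ker π).subtype) β.span_eq
    rw [Submodule.map_span, ← Set.range_comp, Submodule.map_top, Submodule.range_subtype] at h1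
    exact h1
  let b : Module.Basis (Fin e ⊕ Fin (n - e)) R (Fin n → R) :=
    (Pi.basisFun R (Fin n)).reindex ((finCongr hn.symm).trans finSumFinEquiv.symm)
  have hle := minorsIdeal_le_range_wedgeDet b hπ hψ φ hφ
  have hne : LinearMap.range (wedgeDet b hπ hψ) ≠ ⊤ := by
    intro htop
    have hE := free_of_range_wedgeDet_eq_top b hπ hψ htop
    have h0 := projectiveDimension_le_zero_of_projective (R := R) (E := E)
    rw [hpd] at h0
    exact absurd h0 (by decide)
  refine le_trans ?_ (height_range_le_analyticSpread (wedgeDet b hπ hψ) hne)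
  exact_mod_cast Ideal.height_mono hle
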